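/- Let $m,l\ge 2$ be integers, let $Y$ be a set and let $p=(p_1,\dots,p_l)\colon Y\to\{1,\dots,m\}^l$ be a bijection. For $A\le S_m$ let $[p:A^l]\le \mathrm{Sym}(Y)$ be the group corresponding under $p$ to $A^l$ acting coordinatewise on $\{1,\dots,m\}^l$, and let $[p:A^l]^e=[p:A^l]\cap \mathrm{Alt}(Y)$ be its even part. An imprimitivity system of a transitive group $G\le\mathrm{Sym}(Y)$ is a $G$-invariant partition of $Y$ into subsets of equal size, other than $\{Y\}$ and the partition into singletons; its order is the number of its members. A codirection of $p$ is the set of all fibers of one of the coordinate maps $p_i$. Suppose that $A\le S_m$ is primitive but not regular. Then $[p:A^l]^e$ is transitive and imprimitive on $Y$, with many (at least $2^l-2$) imprimitivity systems. There are exactly $l$ codirections of $p$, and: (1) unless $m$ is a prime with $m\equiv 3\pmod 4$, $A$ is the dihedral group $D_{2m}$ of order $2m$, and $l=2$, the imprimitivity systems of order $m$ of $[p:A^l]^e$ are precisely the $l$ codirections of $p$; (2) if $m$ is a prime with $m\equiv 3\pmod 4$, $A$ is the dihedral group $D_{2m}$ of order $2m$, and $l=2$, then $[p:A^l]^e$ has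 exactly $m+1$ imprimitivity systems of order $m$, and the two codirections of $p$ are among them. -/

import Mathlib

open Equiv

namespace ProductDecomposition

/-- A transitive permutation group is regular if all its point stabilizers are trivial. -/
def IsRegularGroup {X : Type*} (A : Subgroup (Perm X)) : Prop :=
  MulAction.IsPretransitive A X ∧ ∀ x : X, MulAction.stabilizer A x = ⊥

/-- The even part of a permutation group: the subgroup of its even permutations. -/
def evenPart {Y : Type*} [Fintype Y] [DecidableEq Y] (G : Subgroup (Perm Y)) :
    Subgroup (Perm Y) :=
  G ⊓ alternatingGroup Y

/-- `P` is an imprimitivity system of the (transitive) permutation group `G`: a partition of the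
set into subsets of the same order which is preserved by `G` and is neither the partition into
one subset nor the partition into singletons. Its order is the number `P.ncard` of its members. -/
structure IsImprimitivitySystem {Y : Type*} (G : Subgroup (Perm Y)) (P : Set (Set Y)) :
    Prop where
  isPartition : Setoid.IsPartition P
  equipartition : ∀ B ∈ P, ∀ C ∈ P, B.encard = C.encard
  preserved : ∀ g ∈ G, ∀ B ∈ P, g '' B ∈ P
  ne_univ : P ≠ {Set.univ}
  ne_singletons : P ≠ Set.range (fun y : Y => ({y} : Set Y))

/-- The set of the imprimitivity systems of a permutation group. -/
def imprimitivitySystems {Y : Type*} (G : Subgroup (Perm Y)) : Set (Set (Set Y)) :=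
  {P | IsImprimitivitySystem G P}

/-- The set of the imprimitivity systems having exactly `m` members. -/
def imprimitivitySystemsOfOrder {Y : Type*} (G : Subgroup (Perm Y)) (m : ℕ) :
    Set (Set (Set Y)) :=
  {P | IsImprimitivitySystem G P ∧ P.ncard = m}

/-- An imprimitive group is a transitive group with at least one imprimitivity system. -/
def IsImprimitive {Y : Type*} (G : Subgroup (Perm Y)) : Prop :=
  MulAction.IsPretransitive G Y ∧ ∃ P : Set (Set Y), IsImprimitivitySystem G P

/-- The product action of `(Sym X)^l` on `X^l`, coordinate by coordinate. -/
def productAction (X : Type*) (l : ℕ) : (Fin l → Perm X) →* Perm (Fin l → X) where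
  toFun a := Equiv.piCongrRight a
  map_one' := rfl
  map_mul' _ _ := rfl

/-- The equiproduct decompositions of `Y`: the bijections from `Y` onto `X^l`. -/
abbrev EPDec (Y X : Type*) (l : ℕ) := Y ≃ (Fin l → X)

/-- The permutation group on `Y` corresponding, through the decomposition `p`, to the group `A^l`
in its product action on `X^l`. -/
def baseGroup {Y X : Type*} {l : ℕ} (p : EPDec Y X l) (A : Subgroup (Perm X)) :
    Subgroup (Perm Y) :=
  (Subgroup.pi Set.univ (fun _ : Fin l => A)).map
    (p.symm.permCongrHom.toMonoidHom.comp (productAction X l))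

/-- The `i`-th codirection of `p`: the set of all fibers of the `i`-th projection of `p`. -/
def codirection {Y X : Type*} {l : ℕ} (p : EPDec Y X l) (i : Fin l) : Set (Set Y) :=
  {B | ∃ x ∈ Set.range (fun y => p y i), B = {y | p y i = x}}

/-- The set of all codirections of `p`. -/
def codirections {Y X : Type*} {l : ℕ} (p : EPDec Y X l) : Set (Set (Set Y)) :=
  Set.range (codirection p)

end ProductDecomposition

/-! Let `χ` be the sign that an element of `A` acquires when it acts on one coordinate. The even
part of `A^l` consists of the tuples with `∏ χ (a i) = 1`, and by transitivity its imprimitivity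
systems are the nontrivial invariant equivalence relations. Since `A` is primitive and not regular,
`ker χ` is nontrivial, hence transitive on points. So the tuples over `ker χ` are already
transitive, and `χ` takes all its values on each point stabilizer.

Let `H` be the stabilizer of the class of a point `f`. If `H` moves coordinate `i`, its projection
there properly contains the point stabilizer, which is maximal, so it is all of `A`. Hence the
elements of `H` supported on `i` form a normal subgroup of `A`; if this is nontrivial, it contains
`ker χ`. The class of `f` then fixes a set `J` of coordinates and leaves the others free. Such a
relation has `m ^ |J|` classes, so order `m` gives exactly the codirections
(`IsInvariantSetoid.exists_iff_forall_eq`).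

That normal subgroup is visibly nontrivial when `ker χ` has nontrivial point stabilizers. Otherwise
point stabilizers are `{1, t}` with `χ t = -1`, and with a third coordinate a double commutator
still produces a nontrivial element.

What remains is `l = 2` with `ker χ` regular. Conjugation by `t` is then a fixed-point-free
involution of `ker χ`, hence inversion; primitivity makes `ker χ` cyclic of prime order `m`, so `A`
is dihedral, and `t` being odd gives `m ≡ 3 mod 4` (`exists_isDihedralFrame`). Here the group acts
on the plane over `ZMod m` by translations and point reflections, so its invariant relations are
congruences modulo subgroups, and the proper nontrivial ones are the `m + 1` lines through the
origin. -/

open scoped commutatorElement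

namespace ProductDecomposition

/-! ### Primitive non-regular groups with a sign character -/

section Primitive

open MulAction

variable {A X : Type*} [Group A] [MulAction A X]

theorem exists_smul_eq_of_normal_ne_bot [FaithfulSMul A X] [IsPreprimitive A X]
    (N : Subgroup A) [N.Normal] (hN : N ≠ ⊥) (x y : X) : ∃ n ∈ N, n • x = y := by
  have hfix : fixedPoints N X ≠ Set.univ := by
    intro h
    apply hN
    rw [Subgroup.eq_bot_iff_forall]
    intro n hn
    refine FaithfulSMul.eq_of_smul_eq_smul (α := X) fun z => ?_
    have hz : z ∈ fixedPoints N X := h ▸ Set.mem_univ z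
    rw [one_smul]
    exact hz ⟨n, hn⟩
  have := IsQuasiPreprimitive.isPretransitive_of_normal (G := A) (X := X) hfix
  obtain ⟨n, hn⟩ := MulAction.exists_smul_eq N x y
  exact ⟨n, n.2, hn⟩

theorem stabilizer_ne_bot_of_exists [IsPretransitive A X]
    (h : ∃ x : X, stabilizer A x ≠ ⊥) (y : X) : stabilizer A y ≠ ⊥ := by
  obtain ⟨x, hx⟩ := h
  obtain ⟨g, rfl⟩ := MulAction.exists_smul_eq A x y
  rw [Subgroup.ne_bot_iff_exists_ne_one] at hx
  obtain ⟨⟨s, hs⟩, hs1⟩ := hx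
  rw [Subgroup.ne_bot_iff_exists_ne_one]
  refine ⟨⟨g * s * g⁻¹, ?_⟩, ?_⟩
  · rw [mem_stabilizer_iff] at hs ⊢
    simp [mul_smul, hs]
  · intro h
    apply hs1
    ext
    simpa using h

/-- An element carrying `x` to `y` normalizes the common stabilizer. The stabilizer is maximal, so
its normalizer is itself or `A`; in the latter case it would be a nontrivial normal, hence
transitive, subgroup fixing `x`. -/
theorem eq_of_stabilizer_eq [FaithfulSMul A X] [IsPreprimitive A X] [Nontrivial X]
    (hA : ∀ x : X, stabilizer A x ≠ ⊥) {x y : X} (h : stabilizer A x = stabilizer A y) :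
    x = y := by
  obtain ⟨g, rfl⟩ := MulAction.exists_smul_eq A x y
  have hg : g ∈ Subgroup.normalizer (stabilizer A x : Set A) := by
    rw [Subgroup.mem_normalizer_iff]
    intro s
    conv_rhs => rw [h]
    simp [mem_stabilizer_iff, mul_smul]
  have hco := IsPreprimitive.isCoatom_stabilizer_of_isPreprimitive (G := A) (X := X) x
  rcases hco.le_iff.1 (Subgroup.le_normalizer (H := stabilizer A x)) with htop | heq
  · have hn : (stabilizer A x).Normal := Subgroup.normalizer_eq_top_iff.1 htop
    obtain ⟨z, hz⟩ := exists_ne x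
    obtain ⟨n, hn, hnz⟩ := exists_smul_eq_of_normal_ne_bot (stabilizer A x) (hA x) x z
    exact absurd (hnz.symm.trans hn) hz
  · rw [heq] at hg
    exact hg.symm

/-- If the point stabilizer of `x` is `{1, t}`, then `t` fixes only `x`. -/
theorem eq_of_smul_eq_of_stabilizer_pair [FaithfulSMul A X] [IsPreprimitive A X] [Nontrivial X]
    (hA : ∀ x : X, stabilizer A x ≠ ⊥) {x y : X} {t : A} (ht : t ≠ 1)
    (hs : ∀ s ∈ stabilizer A x, s = 1 ∨ s = t) (hy : t • y = y) : y = x := by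
  obtain ⟨g, rfl⟩ := MulAction.exists_smul_eq A x y
  have htx : t ∈ stabilizer A x := by
    obtain ⟨⟨s, hsx⟩, hs1⟩ := Subgroup.ne_bot_iff_exists_ne_one.1 (hA x)
    rcases hs s hsx with rfl | rfl
    · exact absurd rfl hs1
    · exact hsx
  -- This conjugate is a nontrivial element fixing `x`. So `g` commutes with `t`, and the
  -- stabilizers of `x` and `g • x` coincide.
  have hcomm : g⁻¹ * t * g = t := by
    refine (hs (g⁻¹ * t * g) ?_).resolve_left ?_
    · rw [mem_stabilizer_iff, mul_smul, mul_smul, hy, inv_smul_smul]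
    · intro h
      apply ht
      have : t = g * (g⁻¹ * t * g) * g⁻¹ := by group
      rw [this, h]; group
  refine (eq_of_stabilizer_eq hA (le_antisymm ?_ ?_)).symm
  · intro s hsx
    rcases hs s hsx with rfl | rfl
    · exact one_mem _
    · exact hy
  · intro s hsx
    have h1 : g⁻¹ * s * g ∈ stabilizer A x := by
      rw [mem_stabilizer_iff] at hsx ⊢
      rw [mul_smul, mul_smul, hsx, inv_smul_smul]
    have h2 : s = g * (g⁻¹ * s * g) * g⁻¹ := by group
    rcases hs _ h1 with h | h
    · rw [h2, h, mul_one, mul_inv_cancel]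
      exact one_mem _
    · have h3 : g * t * g⁻¹ = t := by
        conv_lhs => rw [← hcomm]
        group
      rw [h2, h, h3]
      exact htx

variable (χ : A →* ℤˣ)

/-- Otherwise `A` embeds in `ℤˣ` and is abelian, so all point stabilizers coincide. -/
theorem ker_ne_bot [FaithfulSMul A X] [IsPreprimitive A X] [Nontrivial X]
    (hA : ∀ x : X, stabilizer A x ≠ ⊥) : χ.ker ≠ ⊥ := by
  intro h
  have hinj := (MonoidHom.ker_eq_bot_iff χ).1 h
  have hc : ∀ a b : A, a * b = b * a := fun a b => hinj (by rw [map_mul, map_mul, mul_comm])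
  obtain ⟨x, y, hxy⟩ := exists_pair_ne X
  apply hxy
  apply eq_of_stabilizer_eq hA
  obtain ⟨g, rfl⟩ := MulAction.exists_smul_eq A x y
  ext s
  rw [mem_stabilizer_iff, mem_stabilizer_iff, ← mul_smul, hc, mul_smul, smul_left_cancel_iff]

theorem exists_ker_smul_eq [FaithfulSMul A X] [IsPreprimitive A X] [Nontrivial X]
    (hA : ∀ x : X, stabilizer A x ≠ ⊥) (x y : X) : ∃ c : A, χ c = 1 ∧ c • x = y :=
  exists_smul_eq_of_normal_ne_bot χ.ker (ker_ne_bot χ hA) x y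

/-- Frattini argument: the kernel is transitive, so `A` is the product of the kernel and a point
stabilizer. -/
theorem exists_stabilizer_map_eq [FaithfulSMul A X] [IsPreprimitive A X] [Nontrivial X]
    (hA : ∀ x : X, stabilizer A x ≠ ⊥) (x : X) (a : A) : ∃ s : A, s • x = x ∧ χ s = χ a := by
  obtain ⟨c, hc, hcx⟩ := exists_ker_smul_eq χ hA x (a • x)
  exact ⟨c⁻¹ * a, by rw [mul_smul, ← hcx, inv_smul_smul], by rw [map_mul, map_inv, hc]; simp⟩

end Primitive

/-! ### Invariant equivalence relations on a power -/

section Product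

open MulAction

variable {A X ι : Type*} [Group A] [MulAction A X] [Fintype ι] (χ : A →* ℤˣ)

/-- The relation `s` on `X^ι` is preserved by the tuples `a` in `A^ι` with `∏ i, χ (a i) = 1`. -/
def IsInvariantSetoid (s : Setoid (ι → X)) : Prop :=
  ∀ a : ι → A, ∏ i, χ (a i) = 1 → ∀ f g, s f g → s (a • f) (a • g)

variable {χ}

theorem IsInvariantSetoid.iff {s : Setoid (ι → X)} (hs : IsInvariantSetoid χ s) {a : ι → A}
    (ha : ∏ i, χ (a i) = 1) (f g : ι → X) : s (a • f) (a • g) ↔ s f g := by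
  refine ⟨fun h => ?_, hs a ha f g⟩
  have := hs a⁻¹ (by simp [ha]) _ _ h
  simpa using this

/-- The tuples moving `f` to a point related to `f`. -/
def IsInvariantSetoid.stab {s : Setoid (ι → X)} (hs : IsInvariantSetoid χ s) (f : ι → X) :
    Subgroup (ι → A) where
  carrier := {a | ∏ i, χ (a i) = 1 ∧ s f (a • f)}
  one_mem' := by simp 
  mul_mem' := by
    rintro a b ⟨ha, ha'⟩ ⟨hb, hb'⟩
    refine ⟨by simp [Finset.prod_mul_distrib, ha, hb], s.trans' ha' ?_⟩
    rw [mul_smul]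
    exact hs a ha _ _ hb'
  inv_mem' := by
    rintro a ⟨ha, ha'⟩
    refine ⟨by simp [ha], s.symm' ?_⟩
    have := hs a⁻¹ (by simp [ha]) _ _ ha'
    simpa using this

theorem IsInvariantSetoid.mem_stab {s : Setoid (ι → X)} (hs : IsInvariantSetoid χ s) {f : ι → X}
    {a : ι → A} : a ∈ hs.stab f ↔ ∏ i, χ (a i) = 1 ∧ s f (a • f) := Iff.rfl

theorem IsInvariantSetoid.mem_stab_of_smul_eq {s : Setoid (ι → X)} (hs : IsInvariantSetoid χ s)
    {f : ι → X} {a : ι → A} (ha : ∏ i, χ (a i) = 1) (h : ∀ i, a i • f i = f i) :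
    a ∈ hs.stab f := by
  refine hs.mem_stab.2 ⟨ha, ?_⟩
  have : a • f = f := funext h
  rw [this]

variable [DecidableEq ι]

theorem prod_map_mulSingle (i : ι) (a : A) :
    ∏ j, χ ((Pi.mulSingle i a : ι → A) j) = χ a := by
  rw [Finset.prod_eq_single i]
  · simp
  · intro j _ hj
    simp [Pi.mulSingle_eq_of_ne hj]
  · simp

theorem prod_map_mulSingle_mul (i j : ι) (a b : A) :
    ∏ k, χ ((Pi.mulSingle i a * Pi.mulSingle j b : ι → A) k) = χ a * χ b := by
  simp only [Pi.mul_apply, map_mul, Finset.prod_mul_distrib, prod_map_mulSingle]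

theorem IsInvariantSetoid.mulSingle_mem_stab {s : Setoid (ι → X)} (hs : IsInvariantSetoid χ s)
    {f : ι → X} {i : ι} {a : A} (ha : χ a = 1) (h : a • f i = f i) :
    Pi.mulSingle i a ∈ hs.stab f := by
  refine hs.mem_stab_of_smul_eq ((prod_map_mulSingle i a).trans ha) fun j => ?_
  by_cases hj : j = i
  · subst hj; simpa using h
  · simp [Pi.mulSingle_eq_of_ne hj]

theorem IsInvariantSetoid.mulSingle_mul_mem_stab {s : Setoid (ι → X)}
    (hs : IsInvariantSetoid χ s) {f : ι → X} {i j : ι} {a b : A} (hab : χ a * χ b = 1)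
    (ha : a • f i = f i) (hb : b • f j = f j) :
    Pi.mulSingle i a * Pi.mulSingle j b ∈ hs.stab f := by
  refine hs.mem_stab_of_smul_eq ((prod_map_mulSingle_mul i j a b).trans hab) fun k => ?_
  rw [Pi.mul_apply, mul_smul]
  have h1 : (Pi.mulSingle j b : ι → A) k • f k = f k := by
    by_cases hj : k = j
    · subst hj; simpa using hb
    · simp [Pi.mulSingle_eq_of_ne hj]
  rw [h1]
  by_cases hj : k = i
  · subst hj; simpa using ha
  · simp [Pi.mulSingle_eq_of_ne hj]

variable [FaithfulSMul A X] [IsPreprimitive A X] [Nontrivial X]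

/-- A subgroup of tuples moving the `i`-th coordinate of `f` projects onto `A`. -/
theorem IsInvariantSetoid.exists_mem_stab_apply_eq (hA : ∀ x : X, stabilizer A x ≠ ⊥)
    [Nontrivial ι] {s : Setoid (ι → X)} (hs : IsInvariantSetoid χ s) {f : ι → X} {i : ι}
    (hi : ∃ h ∈ hs.stab f, h i • f i ≠ f i) (a : A) : ∃ h ∈ hs.stab f, h i = a := by
  have hco := IsPreprimitive.isCoatom_stabilizer_of_isPreprimitive (G := A) (X := X) (f i)
  -- The sign of `b` is compensated at another coordinate `j` by an element fixing `f j`. The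
  -- projection thus contains a maximal subgroup.
  have hle : stabilizer A (f i) ≤ (hs.stab f).map (Pi.evalMonoidHom (fun _ : ι => A) i) := by
    intro b hb
    obtain ⟨j, hj⟩ := exists_ne i
    obtain ⟨b', hb', hχ⟩ := exists_stabilizer_map_eq χ hA (f j) b⁻¹
    refine ⟨_, hs.mulSingle_mul_mem_stab (i := i) (j := j) (a := b) (b := b') ?_ hb hb', ?_⟩
    · rw [hχ, map_inv, mul_inv_cancel]
    · simp [Pi.mulSingle_eq_of_ne hj.symm]
  rcases hco.le_iff.1 hle with htop | heq
  · have : a ∈ (hs.stab f).map (Pi.evalMonoidHom (fun _ : ι => A) i) := htop ▸ Subgroup.mem_top a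
    exact this
  · obtain ⟨h, hh, hne⟩ := hi
    have : h i ∈ stabilizer A (f i) := heq ▸ ⟨h, hh, rfl⟩
    exact absurd this hne

/-- If some tuple in the stabilizer of the class of `f` moves the `i`-th coordinate and the
`i`-th factor of that stabilizer is nontrivial, this factor contains the kernel of `χ`. -/
theorem IsInvariantSetoid.mulSingle_mem_stab_of_ne_one (hA : ∀ x : X, stabilizer A x ≠ ⊥)
    [Nontrivial ι] {s : Setoid (ι → X)} (hs : IsInvariantSetoid χ s) {f : ι → X} {i : ι}
    (hi : ∃ h ∈ hs.stab f, h i • f i ≠ f i) (hne : ∃ a ≠ 1, Pi.mulSingle i a ∈ hs.stab f)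
    {c : A} (hc : χ c = 1) : Pi.mulSingle i c ∈ hs.stab f := by
  let K : Subgroup A := (hs.stab f).comap (MonoidHom.mulSingle (fun _ : ι => A) i)
  have hK : ∀ a, a ∈ K ↔ Pi.mulSingle i a ∈ hs.stab f := fun a => Iff.rfl
  -- Conjugating by `h` a tuple supported on `i` conjugates its entry by `h i`, which is arbitrary.
  have : K.Normal := by
    constructor
    intro a ha g
    obtain ⟨h, hh, rfl⟩ := hs.exists_mem_stab_apply_eq hA hi g
    rw [hK] at ha ⊢
    have : Pi.mulSingle i (h i * a * (h i)⁻¹) = h * Pi.mulSingle i a * h⁻¹ := by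
      ext j
      by_cases hj : j = i
      · subst hj; simp
      · simp [Pi.mulSingle_eq_of_ne hj]
    rw [this]
    exact mul_mem (mul_mem hh ha) (inv_mem hh)
  have hKb : K ≠ ⊥ := by
    obtain ⟨a, ha, ha'⟩ := hne
    intro h
    have : a ∈ K := ha'
    rw [h, Subgroup.mem_bot] at this
    exact ha this
  obtain ⟨k, hk, hkx⟩ := exists_smul_eq_of_normal_ne_bot K hKb (f i) (c • f i)
  have hχk : χ k = 1 := by
    rw [← prod_map_mulSingle (χ := χ) i k]
    exact hk.1
  -- The second factor fixes `f i` and lies in the kernel, so it belongs to the stabilizer already.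
  have : c = k * (k⁻¹ * c) := by group
  rw [← hK, this]
  refine mul_mem hk (hs.mulSingle_mem_stab (by simp [hχk, hc]) ?_)
  rw [mul_smul, ← hkx, inv_smul_smul]

/-- The `i`-th factor of the stabilizer of a class is nontrivial as soon as the stabilizer moves
the `i`-th coordinate, if the kernel of `χ` is not regular or there are at least three factors. -/
theorem IsInvariantSetoid.exists_ne_one_mulSingle_mem_stab (hA : ∀ x : X, stabilizer A x ≠ ⊥)
    [Nontrivial ι]
    (hχ : (∀ x : X, ∃ a : A, a ≠ 1 ∧ a • x = x ∧ χ a = 1) ∨ 3 ≤ Fintype.card ι)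
    {s : Setoid (ι → X)} (hs : IsInvariantSetoid χ s) {f : ι → X} {i : ι}
    (hi : ∃ h ∈ hs.stab f, h i • f i ≠ f i) : ∃ a ≠ 1, Pi.mulSingle i a ∈ hs.stab f := by
  by_cases hreg : ∃ a : A, a ≠ 1 ∧ a • f i = f i ∧ χ a = 1
  · obtain ⟨a, ha, hax, haχ⟩ := hreg
    exact ⟨a, ha, hs.mulSingle_mem_stab haχ hax⟩
  have hcard : 3 ≤ Fintype.card ι := hχ.resolve_left fun h => hreg (h _)
  push Not at hreg
  obtain ⟨j, hji, k, hki, hjk⟩ : ∃ j, j ≠ i ∧ ∃ k, k ≠ i ∧ j ≠ k := by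
    obtain ⟨j, hj⟩ := exists_ne i
    obtain ⟨k, hk⟩ : ∃ k, k ∉ ({i, j} : Finset ι) := by
      by_contra! h
      have := Finset.card_le_card (fun x _ => h x : (Finset.univ : Finset ι) ⊆ {i, j})
      have h2 := Finset.card_le_two (a := i) (b := j)
      rw [Finset.card_univ] at this
      omega
    simp only [Finset.mem_insert, Finset.mem_singleton, not_or] at hk
    exact ⟨j, hj, k, hk.1, fun h => hk.2 h.symm⟩
  obtain ⟨⟨t, htx⟩, ht1⟩ := Subgroup.ne_bot_iff_exists_ne_one.1 (hA (f i))
  replace ht1 : t ≠ 1 := fun h => ht1 (Subtype.ext h)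
  -- Nontrivial elements fixing `f i` have sign `-1`, so two of them differ by an element of sign
  -- `1` fixing `f i`, which is trivial.
  have hpair : ∀ b ∈ stabilizer A (f i), b = 1 ∨ b = t := by
    intro b hb
    by_contra! hcon
    have h1 := hreg t ht1 htx
    have h2 := hreg b hcon.1 hb
    have h3 := hreg (b⁻¹ * t) (fun h => hcon.2 (inv_mul_eq_one.1 h)) (mul_mem (inv_mem hb) htx)
    rw [map_mul, map_inv] at h3
    rw [Int.units_ne_iff_eq_neg] at h1 h2
    rw [h1, h2] at h3
    simp at h3
  -- Such a `c` permutes the fixed points of `t`, and `f i` is the only one.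
  have hcomm : ∀ c : A, χ c = 1 → c * t = t * c → c = 1 := by
    intro c hc hct
    by_contra hc1
    have : c • f i = f i := by
      apply eq_of_smul_eq_of_stabilizer_pair hA ht1 hpair
      rw [← mul_smul, ← hct, mul_smul, htx]
    exact hreg c hc1 this hc
  obtain ⟨c, hc1, hc⟩ : ∃ c : A, c ≠ 1 ∧ χ c = 1 := by
    obtain ⟨⟨c, hc⟩, hc1⟩ := Subgroup.ne_bot_iff_exists_ne_one.1 (ker_ne_bot (X := X) χ hA)
    exact ⟨c, fun h => hc1 (Subtype.ext h), hc⟩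
  obtain ⟨h, hh, hhi⟩ := hs.exists_mem_stab_apply_eq hA hi c
  obtain ⟨tj, htj, hχj⟩ := exists_stabilizer_map_eq χ hA (f j) t⁻¹
  obtain ⟨tk, htk, hχk⟩ := exists_stabilizer_map_eq χ hA (f k) t⁻¹
  have hu := hs.mulSingle_mul_mem_stab (f := f) (i := i) (j := j) (a := t) (b := tj)
    (by rw [hχj, map_inv, mul_inv_cancel]) htx htj
  have hv := hs.mulSingle_mul_mem_stab (f := f) (i := i) (j := k) (a := t) (b := tk)
    (by rw [hχk, map_inv, mul_inv_cancel]) htx htk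
  set u : ι → A := Pi.mulSingle i t * Pi.mulSingle j tj
  set v : ι → A := Pi.mulSingle i t * Pi.mulSingle k tk
  have hmem : ⁅⁅h, u⁆, v⁆ ∈ hs.stab f := by
    have hcm : ∀ a ∈ hs.stab f, ∀ b ∈ hs.stab f, ⁅a, b⁆ ∈ hs.stab f := fun a ha b hb => by
      rw [commutatorElement_def]
      exact mul_mem (mul_mem (mul_mem ha hb) (inv_mem ha)) (inv_mem hb)
    exact hcm _ (hcm _ hh _ hu) _ hv
  -- `⁅h, u⁆` is supported on `{i, j}` and `v` on `{i, k}`, so only coordinate `i` survives. The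
  -- entry there is nontrivial by two uses of `hcomm`, as commutators have sign `1`.
  have heq : ⁅⁅h, u⁆, v⁆ = Pi.mulSingle i ⁅⁅c, t⁆, t⁆ := by
    ext q
    by_cases hq : q = i
    · subst hq
      simp [commutatorElement_def, u, v, hhi, Pi.mulSingle_eq_of_ne hji.symm,
        Pi.mulSingle_eq_of_ne hki.symm]
    · by_cases hqj : q = j
      · subst hqj
        simp [commutatorElement_def, v, Pi.mulSingle_eq_of_ne hq, Pi.mulSingle_eq_of_ne hjk]
      · simp [commutatorElement_def, u, Pi.mulSingle_eq_of_ne hq, Pi.mulSingle_eq_of_ne hqj]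
  have hcomm' : ∀ c : A, χ c = 1 → c ≠ 1 → ⁅c, t⁆ ≠ 1 := fun c hc hc1 h =>
    hc1 (hcomm c hc (commutatorElement_eq_one_iff_mul_comm.1 h))
  refine ⟨⁅⁅c, t⁆, t⁆, hcomm' _ ?_ (hcomm' c hc hc1), heq ▸ hmem⟩
  simp [commutatorElement_def, hc]

/-- The equivalence relations on `X^ι` preserved by the tuples with `∏ i, χ (a i) = 1` are those
given by the equality of the coordinates with indices in a fixed set. -/
theorem IsInvariantSetoid.exists_iff_forall_eq (hA : ∀ x : X, stabilizer A x ≠ ⊥)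
    [Nontrivial ι]
    (hχ : (∀ x : X, ∃ a : A, a ≠ 1 ∧ a • x = x ∧ χ a = 1) ∨ 3 ≤ Fintype.card ι)
    {s : Setoid (ι → X)} (hs : IsInvariantSetoid χ s) :
    ∃ J : Set ι, ∀ f g, s f g ↔ ∀ i ∈ J, f i = g i := by
  obtain ⟨x₀⟩ : Nonempty X := inferInstance
  let f₀ : ι → X := fun _ => x₀
  let J : Set ι := {i | ∀ h ∈ hs.stab f₀, h i • f₀ i = f₀ i}
  have hex : ∀ f : ι → X, ∃ a : ι → A, (∀ i, χ (a i) = 1) ∧ a • f₀ = f := by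
    intro f
    choose a ha haf using fun i => exists_ker_smul_eq χ hA (f₀ i) (f i)
    exact ⟨a, ha, funext haf⟩
  have hbase : ∀ g, s f₀ g ↔ ∀ i ∈ J, f₀ i = g i := by
    intro g
    obtain ⟨a, ha, rfl⟩ := hex g
    have hprod : ∏ i, χ (a i) = 1 := Finset.prod_eq_one fun i _ => ha i
    constructor
    · intro h i hi
      exact (hi a ⟨hprod, h⟩).symm
    · intro h
      have : a ∈ hs.stab f₀ := by
        refine Subgroup.pi_mem_of_mulSingle_mem a fun i => ?_
        by_cases hi : i ∈ J
        · exact hs.mulSingle_mem_stab (ha i) (h i hi).symm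
        · have hi' : ∃ h ∈ hs.stab f₀, h i • f₀ i ≠ f₀ i := by
            simpa [J] using hi
          exact hs.mulSingle_mem_stab_of_ne_one hA hi'
            (hs.exists_ne_one_mulSingle_mem_stab hA hχ hi') (ha i)
      exact this.2
  refine ⟨J, fun f g => ?_⟩
  obtain ⟨a, ha, rfl⟩ := hex f
  have hprod : ∏ i, χ (a i) = 1 := Finset.prod_eq_one fun i _ => ha i
  -- Transport by `a` reduces the general pair to the base point `f₀`, with the same `J`.
  obtain ⟨g, rfl⟩ : ∃ g', a • g' = g := ⟨a⁻¹ • g, smul_inv_smul a g⟩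
  rw [hs.iff hprod, hbase]
  refine forall₂_congr fun i _ => ?_
  rw [Pi.smul_apply', Pi.smul_apply', smul_left_cancel_iff]

end Product

/-! ### Imprimitivity systems as invariant equivalence relations -/

section Setoid

variable {Y : Type*}

theorem classes_top [Nonempty Y] : (⊤ : Setoid Y).classes = {Set.univ} := by
  ext B
  constructor
  · rintro ⟨y, rfl⟩
    ext z
    simp
  · rintro rfl
    obtain ⟨y⟩ := ‹Nonempty Y›
    exact ⟨y, by ext z; simp⟩

theorem classes_bot : (⊥ : Setoid Y).classes = Set.range (fun y : Y => ({y} : Set Y)) := by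
  ext B
  constructor
  · rintro ⟨y, rfl⟩
    exact ⟨y, by ext z; simp⟩
  · rintro ⟨y, rfl⟩
    exact ⟨y, by ext z; simp⟩

theorem ncard_classes_eq_natCard_quotient (s : Setoid Y) :
    s.classes.ncard = Nat.card (Quotient s) :=
  (Nat.card_congr s.quotientEquivClasses).symm

theorem ncard_classes_ker {Z : Type*} {f : Y → Z} (hf : Function.Surjective f) :
    (Setoid.ker f).classes.ncard = Nat.card Z := by
  rw [ncard_classes_eq_natCard_quotient]
  exact Nat.card_congr (Setoid.quotientKerEquivOfSurjective f hf)

/-- The condition of equal sizes is automatic: by transitivity some group element carries any class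
onto any other. -/
theorem isImprimitivitySystem_classes_iff [Nonempty Y] {G : Subgroup (Perm Y)}
    (hG : MulAction.IsPretransitive G Y) (s : Setoid Y) :
    IsImprimitivitySystem G s.classes ↔
      (∀ g ∈ G, ∀ x y, s x y → s (g x) (g y)) ∧ s ≠ ⊤ ∧ s ≠ ⊥ := by
  constructor
  · intro h
    refine ⟨fun g hg x y hxy => ?_, ?_, ?_⟩
    · rw [Setoid.rel_iff_exists_classes]
      obtain ⟨c, hc, hx, hy⟩ := s.rel_iff_exists_classes.1 hxy
      exact ⟨_, h.preserved g hg c hc, ⟨x, hx, rfl⟩, ⟨y, hy, rfl⟩⟩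
    · rintro rfl
      exact h.ne_univ classes_top
    · rintro rfl
      exact h.ne_singletons classes_bot
  · rintro ⟨h, ht, hb⟩
    have hiff : ∀ g ∈ G, ∀ x y, s (g x) (g y) ↔ s x y := by
      intro g hg x y
      refine ⟨fun hxy => ?_, h g hg x y⟩
      simpa using h g⁻¹ (inv_mem hg) _ _ hxy
    have himage : ∀ g ∈ G, ∀ y, g '' {x | s x y} = {x | s x (g y)} := by
      intro g hg y
      ext x
      constructor
      · rintro ⟨z, hz, rfl⟩
        exact h g hg _ _ hz
      · intro hx
        exact ⟨g⁻¹ x, (hiff g hg _ _).1 (by simpa using hx), by simp⟩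
    refine ⟨s.isPartition_classes, ?_, ?_, ?_, ?_⟩
    · rintro _ ⟨x, rfl⟩ _ ⟨y, rfl⟩
      obtain ⟨g, rfl⟩ := MulAction.exists_smul_eq G x y
      have := himage g g.2 x
      rw [Subgroup.smul_def, Perm.smul_def, ← this, g.1.injective.encard_image]
    · rintro g hg _ ⟨y, rfl⟩
      exact ⟨g y, himage g hg y⟩
    · rw [← classes_top]
      exact fun h => ht (Setoid.classes_inj.2 h)
    · rw [← classes_bot]
      exact fun h => hb (Setoid.classes_inj.2 h)

theorem IsImprimitivitySystem.exists_classes_eq {G : Subgroup (Perm Y)} {P : Set (Set Y)}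
    (h : IsImprimitivitySystem G P) : ∃ s : Setoid Y, s.classes = P :=
  ⟨_, Setoid.classes_mkClasses P h.isPartition⟩

end Setoid

/-! ### Signs in the product action -/

section Sign

variable {X : Type*} [Fintype X] [DecidableEq X] {l : ℕ}

theorem productAction_apply {X : Type*} (a : Fin l → Perm X) (f : Fin l → X) (i : Fin l) :
    productAction X l a f i = a i (f i) := rfl

theorem sign_productAction_mulSingle (i : Fin l) (a : Perm X) :
    Perm.sign (productAction X l (Pi.mulSingle i a)) =
      Perm.sign a ^ (Fintype.card X ^ (l - 1)) := by
  -- Splitting off coordinate `i` shows one copy of `a` for each choice of the other `l - 1`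
  -- coordinates.
  have h : Perm.sign (productAction X l (Pi.mulSingle i a)) =
      Perm.sign (prodCongrLeft fun _ : ({j : Fin l // j ≠ i} → X) => a) := by
    refine Perm.sign_eq_sign_of_equiv _ _ (Equiv.funSplitAt i X) fun f => ?_
    ext j
    · simp [productAction_apply]
    · simp [productAction_apply, Pi.mulSingle_eq_of_ne j.2]
  rw [h, Perm.sign_prodCongrLeft]
  simp

theorem sign_productAction (a : Fin l → Perm X) :
    Perm.sign (productAction X l a) = ∏ i, Perm.sign (a i) ^ (Fintype.card X ^ (l - 1)) := by
  let ψ : (Fin l → Perm X) →* ℤˣ :=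
    { toFun := fun a => ∏ i, Perm.sign (a i) ^ (Fintype.card X ^ (l - 1))
      map_one' := by simp
      map_mul' := fun a b => by simp [mul_pow, Finset.prod_mul_distrib] }
  -- Both sides are homomorphisms, so it suffices to compare them on tuples supported on one
  -- coordinate.
  have : a ∈ (Perm.sign.comp (productAction X l)).eqLocus ψ := by
    refine Subgroup.pi_mem_of_mulSingle_mem a fun i => ?_
    change Perm.sign (productAction X l (Pi.mulSingle i (a i))) =
      ∏ j, Perm.sign ((Pi.mulSingle i (a i) : Fin l → Perm X) j) ^ (Fintype.card X ^ (l - 1))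
    rw [sign_productAction_mulSingle, Finset.prod_eq_single i]
    · simp
    · intro j _ hj
      simp [Pi.mulSingle_eq_of_ne hj]
    · simp
  exact this

end Sign

/-! ### The even part as tuples, and the coordinate partitions -/

section Base

variable {Y : Type*} {l m : ℕ}

/-- The sign of the permutation of `X^l` induced by an element of `A` acting on one coordinate. -/
def coordSign (l : ℕ) (A : Subgroup (Perm (Fin m))) : A →* ℤˣ :=
  (Perm.sign ^ (m ^ (l - 1))).comp A.subtype

theorem coordSign_apply (A : Subgroup (Perm (Fin m))) (a : A) :
    coordSign l A a = Perm.sign (a : Perm (Fin m)) ^ (m ^ (l - 1)) := rfl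

theorem mem_evenPart_baseGroup [Fintype Y] [DecidableEq Y] (p : EPDec Y (Fin m) l)
    (A : Subgroup (Perm (Fin m))) (g : Perm Y) :
    g ∈ evenPart (baseGroup p A) ↔
      ∃ a : Fin l → A, ∏ i, coordSign l A (a i) = 1 ∧ ∀ y, g y = p.symm (a • p y) := by
  have hsign : ∀ a : Fin l → Perm (Fin m),
      Perm.sign (p.symm.permCongr (productAction (Fin m) l a)) =
        ∏ i, Perm.sign (a i) ^ (m ^ (l - 1)) := by
    intro a
    rw [Perm.sign_permCongr, sign_productAction, Fintype.card_fin]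
  constructor
  · rintro ⟨⟨a, ha, rfl⟩, hg⟩
    replace hg := Perm.mem_alternatingGroup.1 hg
    refine ⟨fun i => ⟨a i, ha i (Set.mem_univ i)⟩, ?_, fun y => rfl⟩
    exact (hsign a).symm.trans hg
  · rintro ⟨a, ha, hg⟩
    have hg' : g = p.symm.permCongr (productAction (Fin m) l fun i => a i) :=
      Equiv.ext hg
    refine ⟨⟨fun i => a i, fun i _ => (a i).2, hg'.symm⟩, ?_⟩
    refine Perm.mem_alternatingGroup.2 ?_
    rw [hg', hsign]
    exact ha

theorem invariant_iff_isInvariantSetoid [Fintype Y] [DecidableEq Y] (p : EPDec Y (Fin m) l)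
    (A : Subgroup (Perm (Fin m))) (s : Setoid Y) :
    (∀ g ∈ evenPart (baseGroup p A), ∀ x y, s x y → s (g x) (g y)) ↔
      IsInvariantSetoid (coordSign l A) (s.comap p.symm) := by
  constructor
  · intro h a ha f g hfg
    have hmem : p.symm.permCongr (productAction (Fin m) l fun i => a i) ∈
        evenPart (baseGroup p A) :=
      (mem_evenPart_baseGroup p A _).2 ⟨a, ha, fun y => rfl⟩
    have := h _ hmem _ _ hfg
    rw [Equiv.permCongr_apply, Equiv.permCongr_apply, Equiv.symm_symm,
      Equiv.apply_symm_apply, Equiv.apply_symm_apply] at this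
    exact this
  · intro h g hg x y hxy
    obtain ⟨a, ha, hga⟩ := (mem_evenPart_baseGroup p A g).1 hg
    rw [hga, hga]
    refine h a ha (p x) (p y) ?_
    rw [Setoid.comap_rel]
    simpa using hxy

theorem isPretransitive_evenPart_baseGroup [Fintype Y] [DecidableEq Y]
    [Nontrivial (Fin m)] (p : EPDec Y (Fin m) l) (A : Subgroup (Perm (Fin m)))
    [MulAction.IsPreprimitive A (Fin m)] (hA : ∀ x : Fin m, MulAction.stabilizer A x ≠ ⊥) :
    MulAction.IsPretransitive (evenPart (baseGroup p A)) Y := by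
  refine ⟨fun x y => ?_⟩
  choose a ha hax using fun i => exists_ker_smul_eq (coordSign l A) hA (p x i) (p y i)
  refine ⟨⟨p.symm.permCongr (productAction (Fin m) l fun i => a i),
    (mem_evenPart_baseGroup p A _).2
      ⟨a, Finset.prod_eq_one fun i _ => ha i, fun y => rfl⟩⟩, ?_⟩
  apply p.injective
  funext i
  rw [← hax i]
  change p (p.symm.permCongr (productAction (Fin m) l fun i => a i) x) i = _
  rw [Equiv.permCongr_apply, Equiv.apply_symm_apply]
  rfl

/-- The equivalence relation on `Y` of having the same coordinates with indices in `J`. -/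
def coordSetoid {X : Type*} (p : EPDec Y X l) (J : Finset (Fin l)) : Setoid Y :=
  Setoid.ker fun y (i : J) => p y i

theorem coordSetoid_rel {X : Type*} {p : EPDec Y X l} {J : Finset (Fin l)} {x y : Y} :
    coordSetoid p J x y ↔ ∀ i ∈ J, p x i = p y i := by
  rw [coordSetoid, Setoid.ker_def, funext_iff]
  exact Subtype.forall

theorem coordSetoid_injective {X : Type*} [Nontrivial X] (p : EPDec Y X l) :
    Function.Injective (coordSetoid p) := by
  intro J K h
  have key : ∀ J K : Finset (Fin l), coordSetoid p J = coordSetoid p K → J ⊆ K := by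
    intro J K h i hi
    by_contra hK
    obtain ⟨u, v, huv⟩ := exists_pair_ne X
    have hrel : coordSetoid p K (p.symm fun _ => u)
        (p.symm (Function.update (fun _ => u) i v)) := by
      rw [coordSetoid_rel]
      intro j hj
      rw [apply_symm_apply, apply_symm_apply, Function.update_of_ne (by rintro rfl; exact hK hj)]
    rw [← h, coordSetoid_rel] at hrel
    have := hrel i hi
    rw [apply_symm_apply, apply_symm_apply, Function.update_self] at this
    exact huv this
  exact (key J K h).antisymm (key K J h.symm)

theorem coordSetoid_empty {X : Type*} (p : EPDec Y X l) : coordSetoid p ∅ = ⊤ := by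
  ext x y
  simp [coordSetoid_rel]

theorem coordSetoid_univ {X : Type*} (p : EPDec Y X l) : coordSetoid p Finset.univ = ⊥ := by
  ext x y
  simp [coordSetoid_rel, ← funext_iff]

theorem ncard_classes_coordSetoid (p : EPDec Y (Fin m) l) (hm : 0 < m) (J : Finset (Fin l)) :
    (coordSetoid p J).classes.ncard = m ^ J.card := by
  have hsurj : Function.Surjective fun y (i : J) => p y i := by
    intro f
    refine ⟨p.symm fun i => if h : i ∈ J then f ⟨i, h⟩ else ⟨0, hm⟩, ?_⟩
    ext i
    simp
  rw [coordSetoid, ncard_classes_ker hsurj]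
  simp

theorem codirection_eq_classes {X : Type*} (p : EPDec Y X l) (i : Fin l) :
    codirection p i = (coordSetoid p {i}).classes := by
  ext B
  constructor
  · rintro ⟨_, ⟨y, rfl⟩, rfl⟩
    exact ⟨y, by ext z; simp [coordSetoid_rel]⟩
  · rintro ⟨y, rfl⟩
    exact ⟨p y i, ⟨y, rfl⟩, by ext z; simp [coordSetoid_rel]⟩

theorem codirection_injective {X : Type*} [Nontrivial X] (p : EPDec Y X l) :
    Function.Injective (codirection p) := by
  intro i j h
  rw [codirection_eq_classes, codirection_eq_classes] at h
  exact Finset.singleton_injective (coordSetoid_injective p (Setoid.classes_inj.2 h))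

theorem ncard_codirections {X : Type*} [Nontrivial X] (p : EPDec Y X l) :
    (codirections p).ncard = l := by
  rw [codirections, ← Set.image_univ, Set.ncard_image_of_injective _ (codirection_injective p)]
  simp [Set.ncard_univ]

theorem isInvariantSetoid_coordSetoid (p : EPDec Y (Fin m) l) (A : Subgroup (Perm (Fin m)))
    (J : Finset (Fin l)) :
    IsInvariantSetoid (coordSign l A) ((coordSetoid p J).comap p.symm) := by
  intro a _ f g h
  rw [Setoid.comap_rel, coordSetoid_rel] at h ⊢
  intro i hi
  have := h i hi
  rw [apply_symm_apply, apply_symm_apply] at this ⊢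
  rw [Pi.smul_apply', Pi.smul_apply', this]

/-! ### Imprimitivity systems from coordinates -/

section Systems

variable [Fintype Y] [DecidableEq Y] [Nontrivial (Fin m)] (p : EPDec Y (Fin m) l)
  (A : Subgroup (Perm (Fin m))) [MulAction.IsPreprimitive A (Fin m)]

theorem classes_mem_imprimitivitySystems_iff
    (hA : ∀ x : Fin m, MulAction.stabilizer A x ≠ ⊥) (s : Setoid Y) :
    s.classes ∈ imprimitivitySystems (evenPart (baseGroup p A)) ↔
      IsInvariantSetoid (coordSign l A) (s.comap p.symm) ∧ s ≠ ⊤ ∧ s ≠ ⊥ := by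
  have : Nonempty Y := ⟨p.symm fun _ => Classical.arbitrary (Fin m)⟩
  rw [← invariant_iff_isInvariantSetoid]
  exact isImprimitivitySystem_classes_iff (isPretransitive_evenPart_baseGroup p A hA) s

theorem classes_coordSetoid_mem (hA : ∀ x : Fin m, MulAction.stabilizer A x ≠ ⊥)
    {J : Finset (Fin l)} (hJ : J ≠ ∅) (hJ' : J ≠ Finset.univ) :
    (coordSetoid p J).classes ∈ imprimitivitySystems (evenPart (baseGroup p A)) := by
  rw [classes_mem_imprimitivitySystems_iff p A hA]
  refine ⟨isInvariantSetoid_coordSetoid p A J, fun h => ?_, fun h => ?_⟩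
  · exact hJ (coordSetoid_injective p (h.trans (coordSetoid_empty p).symm))
  · exact hJ' (coordSetoid_injective p (h.trans (coordSetoid_univ p).symm))

theorem le_ncard_imprimitivitySystems (hl : 0 < l)
    (hA : ∀ x : Fin m, MulAction.stabilizer A x ≠ ⊥) :
    2 ^ l - 2 ≤ (imprimitivitySystems (evenPart (baseGroup p A))).ncard := by
  -- Distinct proper nonempty sets of coordinates give distinct systems; the two excluded sets give
  -- the trivial partitions.
  let T : Finset (Finset (Fin l)) := Finset.univ \ {∅, Finset.univ}
  have hT : T.card = 2 ^ l - 2 := by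
    have hne : (∅ : Finset (Fin l)) ≠ Finset.univ := by
      have : Nonempty (Fin l) := ⟨⟨0, hl⟩⟩
      exact (Finset.univ_nonempty.ne_empty).symm
    rw [Finset.card_sdiff_of_subset (Finset.subset_univ _), Finset.card_pair hne]
    simp
  have hinj : Function.Injective fun J => (coordSetoid p J).classes := fun J K h =>
    coordSetoid_injective p (Setoid.classes_inj.2 h)
  rw [← hT, ← Set.ncard_coe_finset, ← Set.ncard_image_of_injective _ hinj]
  refine Set.ncard_le_ncard ?_ (Set.toFinite _)
  rintro _ ⟨J, hJ, rfl⟩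
  simp only [T, Finset.coe_sdiff, Finset.coe_univ, Set.mem_sdiff, Set.mem_univ, true_and,
    Finset.coe_insert, Finset.coe_singleton, Set.mem_insert_iff, Set.mem_singleton_iff,
    not_or] at hJ
  exact classes_coordSetoid_mem p A hA hJ.1 hJ.2

theorem codirections_subset (hl : 2 ≤ l) (hA : ∀ x : Fin m, MulAction.stabilizer A x ≠ ⊥) :
    codirections p ⊆ imprimitivitySystemsOfOrder (evenPart (baseGroup p A)) m := by
  rintro _ ⟨i, rfl⟩
  rw [codirection_eq_classes]
  refine ⟨classes_coordSetoid_mem p A hA (Finset.singleton_ne_empty i) fun h => ?_, ?_⟩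
  · have := congrArg Finset.card h
    simp at this
    omega
  · rw [ncard_classes_coordSetoid p (Fin.pos_iff_nonempty.2 inferInstance)]
    simp

theorem imprimitivitySystemsOfOrder_eq_codirections (hm : 2 ≤ m) (hl : 2 ≤ l)
    (hA : ∀ x : Fin m, MulAction.stabilizer A x ≠ ⊥)
    (hχ : (∀ x : Fin m, ∃ a : A, a ≠ 1 ∧ a • x = x ∧ coordSign l A a = 1) ∨ 3 ≤ l) :
    imprimitivitySystemsOfOrder (evenPart (baseGroup p A)) m = codirections p := by
  classical
  refine Set.Subset.antisymm ?_ (codirections_subset p A hl hA)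
  rintro P ⟨hP, hPm⟩
  obtain ⟨s, rfl⟩ := hP.exists_classes_eq
  have hinv := ((classes_mem_imprimitivitySystems_iff p A hA s).1 hP).1
  have : Nontrivial (Fin l) := Fin.nontrivial_iff_two_le.2 hl
  obtain ⟨J, hJ⟩ := hinv.exists_iff_forall_eq hA (by simpa using hχ)
  have hs : s = coordSetoid p J.toFinset := by
    ext x y
    have := hJ (p x) (p y)
    rw [Setoid.comap_rel, symm_apply_apply, symm_apply_apply] at this
    rw [this, coordSetoid_rel]
    simp
  rw [hs, ncard_classes_coordSetoid p (by omega)] at hPm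
  have hcard : J.toFinset.card = 1 := Nat.pow_right_injective hm (hPm.trans (pow_one m).symm)
  obtain ⟨i, hi⟩ := Finset.card_eq_one.1 hcard
  exact ⟨i, by rw [codirection_eq_classes, hs, hi]⟩

end Systems

end Base

/-! ### The case of a regular kernel: dihedral groups -/

section Dihedral

open MulAction

variable {A X : Type*} [Group A] [MulAction A X]

/-- The kernel of `χ` is generated by `c` of prime order `m` and is regular on `X`, the point `x`
has stabilizer `{1, t}`, and `t` inverts `c`. -/
structure IsDihedralFrame (χ : A →* ℤˣ) (m : ℕ) (x : X) (c t : A) : Prop where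
  prime : m.Prime
  orderOf_eq : orderOf c = m
  map_c : χ c = 1
  map_t : χ t = -1
  smul_t : t • x = x
  mul_self : t * t = 1
  conj_c : t * c * t = c⁻¹
  mem_zpowers : ∀ d, χ d = 1 → d ∈ Subgroup.zpowers c
  exists_zpow_smul : ∀ y : X, ∃ n : ℤ, c ^ n • x = y
  eq_one : ∀ a : A, a • x = x → χ a = 1 → a = 1
  eq_of_smul_eq : ∀ y : X, t • y = y → y = x

variable {χ : A →* ℤˣ} {x : X}

theorem eq_one_or_eq_of_map_ne_one (hreg : ∀ a : A, a • x = x → χ a = 1 → a = 1) {t : A}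
    (htx : t • x = x) (ht : χ t ≠ 1) {s : A} (hs : s • x = x) : s = 1 ∨ s = t := by
  by_cases h : χ s = 1
  · exact Or.inl (hreg s hs h)
  · right
    replace h := Int.units_ne_iff_eq_neg.1 h
    replace ht := Int.units_ne_iff_eq_neg.1 ht
    have := hreg (s⁻¹ * t) (by rw [mul_smul, htx, inv_smul_eq_iff, hs]) (by simp [h, ht])
    exact (inv_mul_eq_one.1 this)

/-- Conjugation by `t` is an involutive automorphism of the finite group `ker χ` fixing only `1`,
and such an automorphism is inversion. -/
theorem conj_eq_inv_of_fixedPointFree [Finite A] {t : A} (htt : t * t = 1)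
    (hcomm : ∀ c : A, χ c = 1 → c * t = t * c → c = 1) {c : A} (hc : χ c = 1) :
    t * c * t = c⁻¹ := by
  have htinv : t⁻¹ = t := inv_eq_of_mul_eq_one_left htt
  let φ : χ.ker →* χ.ker := (MulAut.conjNormal t : χ.ker ≃* χ.ker).toMonoidHom
  have hφ : ∀ d : χ.ker, ((φ d : χ.ker) : A) = t * d * t := fun d => by
    conv_rhs => rw [← htinv]
    simp [φ, htinv]
  have hfree : MonoidHom.FixedPointFree φ := by
    intro d hd
    have h1 : t * (d : A) * t = d := by rw [← hφ, hd]
    refine Subtype.ext (hcomm d d.2 ?_)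
    conv_lhs => rw [← h1]
    rw [mul_assoc _ t t, htt, mul_one]
  have hinv : Function.Involutive φ := by
    intro d
    apply Subtype.ext
    rw [hφ, hφ]
    calc t * (t * (d : A) * t) * t = (t * t) * d * (t * t) := by group
      _ = d := by rw [htt]; simp
  have := congrFun (hfree.coe_eq_inv_of_involutive hinv) ⟨c, hc⟩
  have h2 := congrArg (Subtype.val) this
  rw [hφ] at h2
  simpa using h2

theorem exists_isDihedralFrame [Finite A] [FaithfulSMul A X] [IsPreprimitive A X] [Nontrivial X]
    [Finite X] (hA : ∀ x : X, stabilizer A x ≠ ⊥)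
    (hreg : ∀ a : A, a • x = x → χ a = 1 → a = 1) :
    ∃ c t, IsDihedralFrame χ (Nat.card X) x c t := by
  obtain ⟨⟨t, htx⟩, ht1⟩ := Subgroup.ne_bot_iff_exists_ne_one.1 (hA x)
  replace ht1 : t ≠ 1 := fun h => ht1 (Subtype.ext h)
  rw [mem_stabilizer_iff] at htx
  have hχt : χ t ≠ 1 := fun h => ht1 (hreg t htx h)
  have hpair : ∀ s ∈ stabilizer A x, s = 1 ∨ s = t := fun s hs =>
    eq_one_or_eq_of_map_ne_one hreg htx hχt hs
  have htt : t * t = 1 := hreg _ (by rw [mul_smul, htx, htx]) (by rw [map_mul, Int.units_mul_self])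
  have hfix : ∀ y : X, t • y = y → y = x := fun y hy =>
    eq_of_smul_eq_of_stabilizer_pair hA ht1 hpair hy
  have hcomm : ∀ c : A, χ c = 1 → c * t = t * c → c = 1 := fun c hc hct =>
    hreg c (hfix _ (by rw [← mul_smul, ← hct, mul_smul, htx])) hc
  have hinv : ∀ c : A, χ c = 1 → t * c * t = c⁻¹ := fun c hc =>
    conj_eq_inv_of_fixedPointFree htt hcomm hc
  -- Inversion on the kernel is a homomorphism, being conjugation by `t`, so the kernel is abelian.
  have hker : ∀ c d : A, χ c = 1 → χ d = 1 → c * d = d * c := by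
    intro c d hc hd
    have h1 := hinv (d⁻¹ * c⁻¹) (by simp [hc, hd])
    have h2 : t * (d⁻¹ * c⁻¹) * t = t * d⁻¹ * (t * t) * c⁻¹ * t := by
      rw [htt]; group
    have h3 : t * d⁻¹ * (t * t) * c⁻¹ * t = (t * d⁻¹ * t) * (t * c⁻¹ * t) := by group
    rw [h2, h3, hinv _ (by simp [hd]), hinv _ (by simp [hc])] at h1
    simpa using h1.symm
  -- An element outside the kernel is a kernel element times `t`: the former centralizes `c`, the
  -- latter inverts it.
  have hnormal : ∀ c : A, χ c = 1 → (Subgroup.zpowers c).Normal := by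
    intro c hc
    constructor
    rintro _ ⟨n, rfl⟩ g
    have hcn : χ (c ^ n) = 1 := by simp [hc]
    by_cases hg : χ g = 1
    · simp only [hker g (c ^ n) hg hcn, mul_inv_cancel_right]
      exact ⟨n, rfl⟩
    · replace hg := Int.units_ne_iff_eq_neg.1 hg
      have hχt := Int.units_ne_iff_eq_neg.1 hχt
      have hgt : χ (g * t) = 1 := by simp [hg, hχt]
      have htinv : t⁻¹ = t := inv_eq_of_mul_eq_one_left htt
      have h1 : g * c ^ n * g⁻¹ = (g * t) * (t * c ^ n * t) * (g * t)⁻¹ := by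
        have : (g * t) * (t * c ^ n * t) * (g * t)⁻¹ = g * (t * t) * c ^ n * t * t⁻¹ * g⁻¹ := by
          group
        rw [this, htt]; group
      rw [h1, hinv _ hcn, hker _ _ hgt (by simp [hc]), mul_inv_cancel_right]
      exact inv_mem ⟨n, rfl⟩
  have htrans : ∀ c : A, χ c = 1 → c ≠ 1 → ∀ y : X, ∃ n : ℤ, c ^ n • x = y := by
    intro c hc hc1 y
    have := hnormal c hc
    obtain ⟨_, ⟨n, rfl⟩, hn⟩ := exists_smul_eq_of_normal_ne_bot (Subgroup.zpowers c)
      (by simpa using hc1) x y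
    exact ⟨n, hn⟩
  have horder : ∀ c : A, χ c = 1 → c ≠ 1 → orderOf c = Nat.card X := by
    intro c hc hc1
    rw [← Nat.card_zpowers]
    refine Nat.card_eq_of_bijective (fun g : Subgroup.zpowers c => (g : A) • x) ⟨?_, ?_⟩
    · rintro ⟨_, ⟨n, rfl⟩⟩ ⟨_, ⟨k, rfl⟩⟩ h
      apply Subtype.ext
      refine inv_mul_eq_one.1 (hreg _ ?_ (by simp [hc]))
      rw [mul_smul, inv_smul_eq_iff]
      exact h.symm
    · intro y
      obtain ⟨n, hn⟩ := htrans c hc hc1 y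
      exact ⟨⟨c ^ n, n, rfl⟩, hn⟩
  obtain ⟨⟨c, hc⟩, hc1⟩ := Subgroup.ne_bot_iff_exists_ne_one.1 (ker_ne_bot (X := X) χ hA)
  replace hc1 : c ≠ 1 := fun h => hc1 (Subtype.ext h)
  replace hc : χ c = 1 := hc
  -- All nontrivial kernel elements have order `Nat.card X`. For a prime divisor `q` with cofactor
  -- `k`, the element `c ^ k` is nontrivial of order dividing `q`, so `Nat.card X = q`.
  have hprime : (Nat.card X).Prime := by
    have hX : Nat.card X ≠ 1 := Finite.one_lt_card.ne'
    obtain ⟨q, hq, k, hk⟩ := Nat.exists_prime_and_dvd hX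
    have hX0 : Nat.card X ≠ 0 := Finite.card_pos.ne'
    have hk0 : k ≠ 0 := by
      rintro rfl
      exact hX0 hk
    have hne : c ^ k ≠ 1 := by
      intro h
      have h1 := orderOf_dvd_of_pow_eq_one h
      rw [horder c hc hc1, hk] at h1
      have h2 := Nat.le_of_dvd (Nat.pos_of_ne_zero hk0) h1
      have h3 := hq.two_le
      nlinarith [Nat.pos_of_ne_zero hk0]
    have h1 : (c ^ k) ^ q = 1 := by
      rw [← pow_mul, mul_comm, ← hk, ← horder c hc hc1, pow_orderOf_eq_one]
    have h2 := orderOf_dvd_of_pow_eq_one h1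
    rw [horder (c ^ k) (by simp [hc]) hne] at h2
    rcases (Nat.dvd_prime hq).1 h2 with h | h
    · exact absurd h hX
    · rwa [h]
  refine ⟨c, t, hprime, horder c hc hc1, hc, Int.units_ne_iff_eq_neg.1 hχt, htx, htt, hinv c hc,
    ?_, htrans c hc hc1, hreg, hfix⟩
  intro d hd
  obtain ⟨n, hn⟩ := htrans c hc hc1 (d • x)
  refine ⟨n, (inv_mul_eq_one.1 (hreg _ ?_ ?_)).symm⟩
  · rw [mul_smul, hn, inv_smul_smul]
  · simp [hc, hd]

namespace IsDihedralFrame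

variable {m : ℕ} {c t : A}

theorem inv_t (h : IsDihedralFrame χ m x c t) : t⁻¹ = t :=
  inv_eq_of_mul_eq_one_left h.mul_self

theorem t_mul_zpow (h : IsDihedralFrame χ m x c t) (n : ℤ) : t * c ^ n = c ^ (-n) * t := by
  have h1 : t * c * t⁻¹ = c⁻¹ := by rw [h.inv_t, h.conj_c]
  have h2 : t * c ^ n * t⁻¹ = c ^ (-n) := by rw [← conj_zpow, h1, inv_zpow, zpow_neg]
  rw [← h2, inv_mul_cancel_right]

theorem zpow_eq_one_iff (h : IsDihedralFrame χ m x c t) (n : ℤ) :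
    c ^ n = 1 ↔ (n : ZMod m) = 0 := by
  rw [← orderOf_dvd_iff_zpow_eq_one, h.orderOf_eq, ZMod.intCast_zmod_eq_zero_iff_dvd]

theorem zpow_eq_zpow_iff (h : IsDihedralFrame χ m x c t) (n k : ℤ) :
    c ^ n = c ^ k ↔ (n : ZMod m) = k := by
  rw [← sub_eq_zero (a := (n : ZMod m)), ← Int.cast_sub, ← h.zpow_eq_one_iff, zpow_sub,
    mul_inv_eq_one]

/-- The power of `c` with exponent an integer modulo the order of `c`. -/
theorem zpow_cast (h : IsDihedralFrame χ m x c t) (n : ℤ) :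
    c ^ ((n : ZMod m).cast : ℤ) = c ^ n := by
  rw [h.zpow_eq_zpow_iff, ZMod.intCast_cast, ZMod.cast_id]

theorem exists_zpow_eq (h : IsDihedralFrame χ m x c t) {a : A} (ha : χ a = 1) :
    ∃ n : ℤ, a = c ^ n := by
  obtain ⟨n, hn⟩ := h.mem_zpowers a ha
  exact ⟨n, hn.symm⟩

theorem exists_mul_zpow_eq (h : IsDihedralFrame χ m x c t) {a : A} (ha : χ a = -1) :
    ∃ n : ℤ, a = t * c ^ n := by
  obtain ⟨n, hn⟩ := h.exists_zpow_eq (a := t * a) (by simp [ha, h.map_t])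
  exact ⟨n, by rw [← hn, ← mul_assoc, h.mul_self, one_mul]⟩

/-- Rotations go to powers of `c` and reflections to `t` times such powers; `χ` tells the two kinds
apart. -/
theorem nonempty_mulEquiv (h : IsDihedralFrame χ m x c t) : Nonempty (A ≃* DihedralGroup m) := by
  let e : DihedralGroup m → A
    | .r i => c ^ (i.cast : ℤ)
    | .sr i => t * c ^ (i.cast : ℤ)
  have her : ∀ n : ℤ, e (.r n) = c ^ n := fun n => h.zpow_cast n
  have hes : ∀ n : ℤ, e (.sr n) = t * c ^ n := fun n => by
    rw [← h.zpow_cast n]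
  have hmul : ∀ u v, e (u * v) = e u * e v := by
    rintro (i | i) (j | j) <;> obtain ⟨i, rfl⟩ := ZMod.intCast_surjective i <;>
      obtain ⟨j, rfl⟩ := ZMod.intCast_surjective j
    · rw [DihedralGroup.r_mul_r, ← Int.cast_add, her, her, her, zpow_add]
    · rw [DihedralGroup.r_mul_sr, ← Int.cast_sub, her, hes, hes, sub_eq_neg_add, zpow_add,
        ← mul_assoc, h.t_mul_zpow, neg_neg, mul_assoc]
    · rw [DihedralGroup.sr_mul_r, ← Int.cast_add, her, hes, hes, zpow_add, mul_assoc]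
    · rw [DihedralGroup.sr_mul_sr, ← Int.cast_sub, her, hes, hes, h.t_mul_zpow i, mul_assoc,
        ← mul_assoc t t, h.mul_self, one_mul, ← zpow_add, sub_eq_neg_add]
  let E : DihedralGroup m →* A := MonoidHom.mk' e hmul
  refine ⟨(MulEquiv.ofBijective E ⟨?_, ?_⟩).symm⟩
  · rw [injective_iff_map_eq_one]
    rintro (i | i) hi <;> obtain ⟨i, rfl⟩ := ZMod.intCast_surjective i
    · have h1 : c ^ i = 1 := (her i).symm.trans hi
      rw [(h.zpow_eq_one_iff i).1 h1, DihedralGroup.r_zero]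
    · have h1 : t * c ^ i = 1 := (hes i).symm.trans hi
      have h2 := congrArg χ h1
      rw [map_mul, map_zpow, h.map_c, h.map_t, map_one, one_zpow, mul_one] at h2
      exact absurd h2 (by decide)
  · intro a
    rcases Int.units_eq_one_or (χ a) with ha | ha
    · obtain ⟨n, rfl⟩ := h.exists_zpow_eq ha
      exact ⟨.r n, her n⟩
    · obtain ⟨n, rfl⟩ := h.exists_mul_zpow_eq ha
      exact ⟨.sr n, hes n⟩

/-- The points of `X` labelled by the integers modulo `m` through the powers of `c`. -/
theorem exists_equiv (h : IsDihedralFrame χ m x c t) :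
    ∃ e : ZMod m ≃ X, (∀ (n : ℤ) i, c ^ n • e i = e (i + n)) ∧ ∀ i, t • e i = e (-i) := by
  have hker : ∀ n : ℤ, c ^ n • x = x → c ^ n = 1 := fun n hn =>
    h.eq_one _ hn (by simp [h.map_c])
  have hbij : Function.Bijective fun i : ZMod m => c ^ (i.cast : ℤ) • x := by
    constructor
    · intro i j
      obtain ⟨i, rfl⟩ := ZMod.intCast_surjective i
      obtain ⟨j, rfl⟩ := ZMod.intCast_surjective j
      simp only [h.zpow_cast]
      intro hij
      have h1 : c ^ (i - j) • x = x := by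
        rw [sub_eq_neg_add, zpow_add, mul_smul, hij, ← mul_smul, ← zpow_add]
        simp
      have h2 := (h.zpow_eq_one_iff _).1 (hker _ h1)
      rwa [Int.cast_sub, sub_eq_zero] at h2
    · intro y
      obtain ⟨n, hn⟩ := h.exists_zpow_smul y
      exact ⟨n, by simp only [h.zpow_cast, hn]⟩
  refine ⟨Equiv.ofBijective _ hbij, fun n i => ?_, fun i => ?_⟩
  · obtain ⟨i, rfl⟩ := ZMod.intCast_surjective i
    rw [← Int.cast_add]
    simp only [Equiv.ofBijective_apply, h.zpow_cast]
    rw [← mul_smul, ← zpow_add, add_comm]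
  · obtain ⟨i, rfl⟩ := ZMod.intCast_surjective i
    rw [← Int.cast_neg]
    simp only [Equiv.ofBijective_apply, h.zpow_cast]
    rw [← mul_smul, h.t_mul_zpow, mul_smul, h.smul_t]

end IsDihedralFrame

end Dihedral

/-! ### Parity of reflections and the degree modulo 4 -/

section Degree

open MulAction

variable {m l : ℕ} (A : Subgroup (Perm (Fin m)))

/-- The sign of an involution with exactly one fixed point. -/
theorem sign_of_mul_self_of_fixedPoint {σ : Perm (Fin m)} (hσ : σ * σ = 1) {x : Fin m}
    (hx : σ x = x) (huniq : ∀ y, σ y = y → y = x) :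
    Perm.sign σ = (-1) ^ ((m - 1) / 2) := by
  have hcard : Fintype.card (Function.fixedPoints σ) = 1 := by
    rw [Fintype.card_eq_one_iff]
    exact ⟨⟨x, hx⟩, fun y => Subtype.ext (huniq y y.2)⟩
  rw [Perm.sign_of_pow_two_eq_one (by rw [sq, hσ]), hcard, Fintype.card_fin]

theorem IsDihedralFrame.mod_four {x : Fin m} {c t : A}
    (h : IsDihedralFrame (coordSign l A) m x c t) : m % 4 = 3 := by
  have hsign : Perm.sign (t : Perm (Fin m)) = -1 := by
    rcases Int.units_eq_one_or (Perm.sign (t : Perm (Fin m))) with h1 | h1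
    · have := h.map_t
      rw [coordSign_apply, h1, one_pow] at this
      exact absurd this (by decide)
    · exact h1
  have h1 := sign_of_mul_self_of_fixedPoint (σ := (t : Perm (Fin m)))
    (congrArg Subtype.val h.mul_self) h.smul_t h.eq_of_smul_eq
  rw [hsign] at h1
  have hodd : ((m - 1) / 2) % 2 = 1 := by
    by_contra hcon
    have heven : Even ((m - 1) / 2) := Nat.even_iff.2 (by omega)
    rw [heven.neg_one_pow] at h1
    exact absurd h1 (by decide)
  -- Because of the rounding in `(m - 1) / 2`, its oddness allows `m % 4` to be `0` or `3`;
  -- primality removes `0`.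
  have h4 : m % 4 ≠ 0 := by
    intro h4
    have h2 : 2 ∣ m := by omega
    have := (Nat.prime_dvd_prime_iff_eq Nat.prime_two h.prime).1 h2
    omega
  omega

/-- In a primitive dihedral group of prime degree `m ≡ 3 mod 4` the reflections are odd. -/
theorem eq_one_of_coordSign_eq_one [Nontrivial (Fin m)] [IsPreprimitive A (Fin m)]
    (hA : ∀ x : Fin m, stabilizer A x ≠ ⊥) (hm : m % 4 = 3)
    (hD : Nonempty (A ≃* DihedralGroup m)) (x : Fin m) (a : A) (hax : a • x = x)
    (ha : coordSign l A a = 1) : a = 1 := by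
  by_contra ha1
  -- The group has order `2 * m` and the orbit of `x` has `m` points. So the stabilizer is `{1, a}`,
  -- where `a` is an involution fixing only `x`, a product of the odd number `(m - 1) / 2` of
  -- transpositions.
  have hcard : Nat.card (stabilizer A x) = 2 := by
    obtain ⟨e⟩ := hD
    have h1 : Nat.card A = 2 * m := by rw [Nat.card_congr e.toEquiv, DihedralGroup.nat_card]
    have h2 := (stabilizer A x).card_mul_index
    rw [index_stabilizer_of_transitive, h1, Nat.card_fin] at h2
    exact Nat.eq_of_mul_eq_mul_right (by omega) h2
  have hmem : a ∈ stabilizer A x := hax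
  have hpair : ∀ s ∈ stabilizer A x, s = 1 ∨ s = a := by
    intro s hs
    by_contra! hcon
    have := Fintype.ofFinite (stabilizer A x)
    have h3 : ({1, ⟨a, hmem⟩, ⟨s, hs⟩} : Finset (stabilizer A x)).card = 3 := by
      rw [Finset.card_eq_three]
      exact ⟨_, _, _, fun h => ha1 (congrArg Subtype.val h).symm,
        fun h => hcon.1 (congrArg Subtype.val h).symm,
        fun h => hcon.2 (congrArg Subtype.val h).symm, rfl⟩
    have h4 := Finset.card_le_univ ({1, ⟨a, hmem⟩, ⟨s, hs⟩} : Finset (stabilizer A x))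
    rw [h3, ← Nat.card_eq_fintype_card, hcard] at h4
    omega
  have haa : a * a = 1 := by
    refine (hpair _ (mul_mem hmem hmem)).resolve_right fun h => ha1 ?_
    simpa using h
  have hsign := sign_of_mul_self_of_fixedPoint (σ := (a : Perm (Fin m)))
    (congrArg Subtype.val haa) hax
    fun y hy => eq_of_smul_eq_of_stabilizer_pair hA ha1 hpair hy
  have hodd : Odd ((m - 1) / 2) := Nat.odd_iff.2 (by omega)
  have hoddm : Odd m := Nat.odd_iff.2 (by omega)
  rw [coordSign_apply, hsign, hodd.neg_one_pow, (hoddm.pow).neg_one_pow] at ha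
  exact absurd ha (by decide)

end Degree

/-! ### Lines through the origin of the plane over `ZMod m` -/

section Line

variable {m : ℕ}

/-- The linear forms on the plane over `ZMod m`, one for each direction. -/
def lineForm : Option (ZMod m) → (ZMod m × ZMod m →+ ZMod m)
  | none => AddMonoidHom.fst _ _
  | some k => AddMonoidHom.snd _ _ - (AddMonoidHom.mulLeft k).comp (AddMonoidHom.fst _ _)

theorem lineForm_none (v : ZMod m × ZMod m) : lineForm none v = v.1 := rfl

theorem lineForm_some (k : ZMod m) (v : ZMod m × ZMod m) :
    lineForm (some k) v = v.2 - k * v.1 := rfl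

theorem lineForm_surjective (o : Option (ZMod m)) : Function.Surjective (lineForm o) := by
  intro z
  cases o with
  | none => exact ⟨(z, 0), rfl⟩
  | some k => exact ⟨(0, z), by simp [lineForm_some]⟩

theorem exists_ne_zero_lineForm_eq_zero [Fact m.Prime] (o : Option (ZMod m)) :
    ∃ v ≠ 0, lineForm o v = 0 := by
  cases o with
  | none => exact ⟨(0, 1), by simp, rfl⟩
  | some k => exact ⟨(1, k), by simp, by simp [lineForm_some]⟩

/-- The vector `(1, k)` lies on the line of slope `k` and on no other; `none` is the vertical line.
-/
theorem eq_of_lineForm_eq_zero_iff [Fact m.Prime] {o o' : Option (ZMod m)}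
    (h : ∀ v, lineForm o v = 0 ↔ lineForm o' v = 0) : o = o' := by
  have key : ∀ (k : ZMod m) (o' : Option (ZMod m)),
      (lineForm (some k) (1, k) = 0 → lineForm o' (1, k) = 0) → some k = o' := by
    intro k o' h
    have h1 := h (by simp [lineForm_some])
    cases o' with
    | none => simp [lineForm_none] at h1
    | some k' =>
      rw [lineForm_some] at h1
      simpa [sub_eq_zero] using h1
  cases o with
  | some k => exact key k o' (h _).1
  | none =>
    cases o' with
    | none => rfl
    | some k' => exact (key k' none (h _).2).symm

theorem addSubgroup_eq_ker_lineForm [Fact m.Prime] (N : AddSubgroup (ZMod m × ZMod m)) :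
    N = ⊥ ∨ N = ⊤ ∨ ∃ o, ∀ v, v ∈ N ↔ lineForm o v = 0 := by
  -- Scalar multiplication is repeated addition, so every subgroup is a subspace. The cases below
  -- ask whether it contains a nonzero vertical vector and whether it contains a non-vertical one.
  have hmul : ∀ (k : ZMod m) (v : ZMod m × ZMod m), v ∈ N → (k * v.1, k * v.2) ∈ N := by
    intro k v hv
    have h1 : (k * v.1, k * v.2) = k.val • v := by
      ext <;> simp
    rw [h1]
    exact nsmul_mem hv _
  by_cases hA : ∃ y : ZMod m, y ≠ 0 ∧ (0, y) ∈ N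
  · obtain ⟨y, hy, hyN⟩ := hA
    have hvert : ∀ z : ZMod m, (0, z) ∈ N := fun z => by
      simpa [hy] using hmul (z / y) _ hyN
    right
    by_cases hB : ∃ v ∈ N, v.1 ≠ 0
    · obtain ⟨v, hv, hv1⟩ := hB
      left
      rw [AddSubgroup.eq_top_iff']
      intro w
      have h1 := add_mem (hmul (w.1 / v.1) v hv) (hvert (w.2 - w.1 / v.1 * v.2))
      have h2 : w = (w.1 / v.1 * v.1, w.1 / v.1 * v.2) + (0, w.2 - w.1 / v.1 * v.2) := by
        ext <;> simp [hv1]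
      rwa [h2]
    · push Not at hB
      right
      refine ⟨none, fun v => ⟨hB v, fun h => ?_⟩⟩
      rw [lineForm_none] at h
      have h1 := hvert v.2
      rwa [← h] at h1
  · push Not at hA
    have hA' : ∀ y : ZMod m, (0, y) ∈ N → y = 0 := fun y hy => by
      by_contra h
      exact hA y h hy
    by_cases hB : ∃ v ∈ N, v.1 ≠ 0
    · obtain ⟨v, hv, hv1⟩ := hB
      right; right
      refine ⟨some (v.2 / v.1), fun w => ?_⟩
      have h1 := hmul (w.1 / v.1) v hv
      have h2 : w = (w.1 / v.1 * v.1, w.1 / v.1 * v.2) +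
          (0, lineForm (some (v.2 / v.1)) w) := by
        ext
        · simp [hv1]
        · simp only [lineForm_some, Prod.snd_add]
          ring
      constructor
      · intro hw
        rw [h2, AddSubgroup.add_mem_cancel_left _ h1] at hw
        exact hA' _ hw
      · intro hw
        rw [h2, hw]
        exact add_mem h1 (zero_mem N)
    · push Not at hB
      left
      rw [AddSubgroup.eq_bot_iff_forall]
      intro v hv
      have h1 := hB v hv
      refine Prod.ext h1 (hA' _ ?_)
      rw [← h1]
      exact hv

end Line

/-- An equivalence relation preserved by all translations is the congruence modulo a subgroup. -/
theorem exists_addSubgroup_of_translation_invariant {V : Type*} [AddCommGroup V] (s : Setoid V)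
    (hs : ∀ w u v, s u v → s (u + w) (v + w)) :
    ∃ N : AddSubgroup V, ∀ u v, s u v ↔ v - u ∈ N := by
  have hsub : ∀ u v, s u v ↔ s 0 (v - u) := by
    intro u v
    constructor
    · intro h
      simpa [sub_eq_add_neg] using hs (-u) _ _ h
    · intro h
      simpa using hs u _ _ h
  refine ⟨{ carrier := {v | s 0 v}
            zero_mem' := s.refl' 0
            add_mem' := fun {u v} hu hv => ?_
            neg_mem' := fun {u} hu => ?_ }, fun u v => hsub u v⟩
  · refine s.trans' (show s 0 v from hv) ?_
    simpa using hs v _ _ (show s 0 u from hu)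
  · refine s.symm' ?_
    simpa using hs (-u) _ _ (show s 0 u from hu)

/-! ### The dihedral case with two factors as a group of the plane -/

section Plane

open MulAction

variable {A X : Type*} [Group A] [MulAction A X] {χ : A →* ℤˣ} {m : ℕ} {x : X} {c t : A}

/-- The coordinates in `ZMod m` of the points of `X^2`. -/
def planeEquiv (e : ZMod m ≃ X) : (Fin 2 → X) ≃ ZMod m × ZMod m :=
  (finTwoArrowEquiv X).trans (e.symm.prodCongr e.symm)

theorem planeEquiv_apply (e : ZMod m ≃ X) (f : Fin 2 → X) :
    planeEquiv e f = (e.symm (f 0), e.symm (f 1)) := rfl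

/-- Tuples with `χ (a 0) * χ (a 1) = 1` act on the plane as translations or as reflections in
points. -/
theorem IsDihedralFrame.planeEquiv_smul (h : IsDihedralFrame χ m x c t) {e : ZMod m ≃ X}
    (hc : ∀ (n : ℤ) i, c ^ n • e i = e (i + n)) (ht : ∀ i, t • e i = e (-i))
    {a : Fin 2 → A} (ha : ∏ i, χ (a i) = 1) :
    (∃ w, ∀ f, planeEquiv e (a • f) = planeEquiv e f + w) ∨
      ∃ w, ∀ f, planeEquiv e (a • f) = -(planeEquiv e f + w) := by
  have hc' : ∀ (n : ℤ) z, e.symm (c ^ n • z) = e.symm z + n := fun n z => by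
    rw [symm_apply_eq, ← hc, apply_symm_apply]
  have ht' : ∀ z, e.symm (t • z) = -e.symm z := fun z => by
    rw [symm_apply_eq, ← ht, apply_symm_apply]
  rw [Fin.prod_univ_two] at ha
  rcases Int.units_eq_one_or (χ (a 0)) with h0 | h0
  · have h1 : χ (a 1) = 1 := by rwa [h0, one_mul] at ha
    obtain ⟨n0, hn0⟩ := h.exists_zpow_eq h0
    obtain ⟨n1, hn1⟩ := h.exists_zpow_eq h1
    refine Or.inl ⟨((n0 : ZMod m), (n1 : ZMod m)), fun f => ?_⟩
    rw [planeEquiv_apply, planeEquiv_apply, Pi.smul_apply', Pi.smul_apply', hn0, hn1, hc', hc']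
    rfl
  · have h1 : χ (a 1) = -1 := by
      rw [h0] at ha
      simpa [neg_eq_iff_eq_neg] using ha
    obtain ⟨n0, hn0⟩ := h.exists_mul_zpow_eq h0
    obtain ⟨n1, hn1⟩ := h.exists_mul_zpow_eq h1
    refine Or.inr ⟨((n0 : ZMod m), (n1 : ZMod m)), fun f => ?_⟩
    rw [planeEquiv_apply, planeEquiv_apply, Pi.smul_apply', Pi.smul_apply', hn0, hn1, mul_smul,
      mul_smul, ht', ht', hc', hc']
    rfl

theorem IsDihedralFrame.exists_smul_symm_planeEquiv (h : IsDihedralFrame χ m x c t)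
    {e : ZMod m ≃ X} (hc : ∀ (n : ℤ) i, c ^ n • e i = e (i + n)) (w : ZMod m × ZMod m) :
    ∃ a : Fin 2 → A, ∏ i, χ (a i) = 1 ∧
      ∀ u, a • (planeEquiv e).symm u = (planeEquiv e).symm (u + w) := by
  obtain ⟨w0, w1⟩ := w
  obtain ⟨n0, rfl⟩ := ZMod.intCast_surjective w0
  obtain ⟨n1, rfl⟩ := ZMod.intCast_surjective w1
  refine ⟨![c ^ n0, c ^ n1], by simp [Fin.prod_univ_two, h.map_c], fun u => ?_⟩
  funext i
  fin_cases i
  · exact hc n0 u.1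
  · exact hc n1 u.2

/-- Translations and point reflections carry each line to a parallel one. -/
theorem IsDihedralFrame.isInvariantSetoid_ker_lineForm (h : IsDihedralFrame χ m x c t)
    {e : ZMod m ≃ X} (hc : ∀ (n : ℤ) i, c ^ n • e i = e (i + n)) (ht : ∀ i, t • e i = e (-i))
    (o : Option (ZMod m)) :
    IsInvariantSetoid χ (Setoid.ker fun f => lineForm o (planeEquiv e f)) := by
  intro a ha f g hfg
  rw [Setoid.ker_def] at hfg ⊢
  rcases h.planeEquiv_smul hc ht ha with ⟨w, hw⟩ | ⟨w, hw⟩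
  · simp only [hw, map_add, hfg]
  · simp only [hw, map_add, map_neg, hfg]

/-- The equivalence relations on `X^2` preserved by the tuples with `χ (a 0) * χ (a 1) = 1` are
the two trivial ones and the parallelisms of lines in the `m + 1` directions. -/
theorem IsInvariantSetoid.eq_ker_lineForm (h : IsDihedralFrame χ m x c t)
    {e : ZMod m ≃ X} (hc : ∀ (n : ℤ) i, c ^ n • e i = e (i + n))
    {s : Setoid (Fin 2 → X)} (hs : IsInvariantSetoid χ s) :
    s = ⊥ ∨ s = ⊤ ∨ ∃ o, s = Setoid.ker fun f => lineForm o (planeEquiv e f) := by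
  have : Fact m.Prime := ⟨h.prime⟩
  obtain ⟨N, hN⟩ := exists_addSubgroup_of_translation_invariant
    (s.comap (planeEquiv e).symm) (by
      intro w u v huv
      obtain ⟨a, ha, haw⟩ := h.exists_smul_symm_planeEquiv hc w
      rw [Setoid.comap_rel, ← haw, ← haw]
      exact hs a ha _ _ huv)
  have hN' : ∀ f g, s f g ↔ planeEquiv e g - planeEquiv e f ∈ N := by
    intro f g
    have h1 := hN (planeEquiv e f) (planeEquiv e g)
    rwa [Setoid.comap_rel, symm_apply_apply, symm_apply_apply] at h1
  rcases addSubgroup_eq_ker_lineForm N with rfl | rfl | ⟨o, ho⟩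
  · left
    ext f g
    rw [hN', AddSubgroup.mem_bot, sub_eq_zero, (planeEquiv e).injective.eq_iff]
    exact eq_comm
  · right; left
    ext f g
    simp [hN']
  · right; right
    refine ⟨o, ?_⟩
    ext f g
    rw [hN', ho, map_sub, sub_eq_zero, Setoid.ker_def]
    exact eq_comm

end Plane

/-! ### Counting the systems in the exceptional case -/

section Exceptional

open MulAction

variable {Y : Type*} [Fintype Y] [DecidableEq Y] {m : ℕ} [Nontrivial (Fin m)]
  (p : EPDec Y (Fin m) 2) (A : Subgroup (Perm (Fin m))) [IsPreprimitive A (Fin m)]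

theorem ncard_imprimitivitySystemsOfOrder_of_isDihedralFrame
    (hA : ∀ x : Fin m, stabilizer A x ≠ ⊥) {x : Fin m} {c t : A}
    (h : IsDihedralFrame (coordSign 2 A) m x c t) :
    (imprimitivitySystemsOfOrder (evenPart (baseGroup p A)) m).ncard = m + 1 := by
  have : Fact m.Prime := ⟨h.prime⟩
  obtain ⟨e, hc, ht⟩ := h.exists_equiv
  let D : Y ≃ ZMod m × ZMod m := p.trans (planeEquiv e)
  let S : Option (ZMod m) → Setoid Y := fun o => Setoid.ker fun y => lineForm o (D y)
  have hSr : ∀ o y z, S o y z ↔ lineForm o (D y) = lineForm o (D z) := fun o y z => Iff.rfl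
  have hscomap : ∀ o, (S o).comap p.symm =
      Setoid.ker fun f => lineForm o (planeEquiv e f) := by
    intro o
    ext f g
    rw [Setoid.comap_rel, hSr, Setoid.ker_def]
    simp [D]
  have hSinj : Function.Injective fun o => (S o).classes := by
    intro o o' hoo
    have h1 : S o = S o' := Setoid.classes_inj.2 hoo
    refine eq_of_lineForm_eq_zero_iff fun v => ?_
    have h2 : S o (D.symm v) (D.symm 0) ↔ S o' (D.symm v) (D.symm 0) := by rw [h1]
    simpa [hSr] using h2
  have hmem : ∀ o, (S o).classes ∈
      imprimitivitySystemsOfOrder (evenPart (baseGroup p A)) m := by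
    intro o
    refine ⟨(classes_mem_imprimitivitySystems_iff p A hA _).2 ⟨?_, ?_, ?_⟩, ?_⟩
    · rw [hscomap]
      exact h.isInvariantSetoid_ker_lineForm hc ht o
    · intro htop
      obtain ⟨v, hv⟩ := lineForm_surjective o 1
      have h1 : S o (D.symm v) (D.symm 0) := by rw [htop]; trivial
      rw [hSr, apply_symm_apply, apply_symm_apply, hv, map_zero] at h1
      exact one_ne_zero h1
    · intro hbot
      obtain ⟨v, hv0, hv⟩ := exists_ne_zero_lineForm_eq_zero o
      have h1 : S o (D.symm v) (D.symm 0) := by simp [hv]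
      rw [hbot] at h1
      exact hv0 (D.symm.injective h1)
    · have hsurj : Function.Surjective fun y => lineForm o (D y) :=
        (lineForm_surjective o).comp D.surjective
      exact (ncard_classes_ker hsurj).trans (by simp)
  have heq : imprimitivitySystemsOfOrder (evenPart (baseGroup p A)) m =
      Set.range fun o => (S o).classes := by
    -- The order `m` is not needed for this inclusion: every imprimitivity system here is a parallel
    -- class of lines.
    refine Set.Subset.antisymm ?_ (Set.range_subset_iff.2 hmem)
    rintro P ⟨hP, -⟩
    obtain ⟨s, rfl⟩ := hP.exists_classes_eq
    obtain ⟨hinv, hst, hsb⟩ := (classes_mem_imprimitivitySystems_iff p A hA s).1 hP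
    have hpull : ∀ s' : Setoid Y, s.comap p.symm = s'.comap p.symm → s = s' := by
      intro s' hs'
      ext y z
      have h1 : s.comap p.symm (p y) (p z) ↔ s'.comap p.symm (p y) (p z) := by rw [hs']
      simpa [Setoid.comap_rel] using h1
    rcases hinv.eq_ker_lineForm h hc with hb | htop | ⟨o, ho⟩
    · refine absurd (hpull ⊥ (hb.trans ?_)) hsb
      ext f g
      exact p.symm.injective.eq_iff.symm
    · exact absurd (hpull ⊤ (htop.trans rfl)) hst
    · exact ⟨o, by rw [hpull (S o) (ho.trans (hscomap o).symm)]⟩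
  rw [heq, ← Set.image_univ, Set.ncard_image_of_injective _ hSinj, Set.ncard_univ,
    Nat.card_eq_fintype_card, Fintype.card_option, ZMod.card]

end Exceptional

end ProductDecomposition

/-! ### The main theorem -/

open ProductDecomposition in
theorem theorem5p7p1 {Y : Type*} [Fintype Y] [DecidableEq Y] (m l : ℕ)
    (hm : 2 ≤ m) (hl : 2 ≤ l) (p : EPDec Y (Fin m) l)
    (A : Subgroup (Equiv.Perm (Fin m)))
    (hprim : MulAction.IsPreprimitive A (Fin m)) (hreg : ¬ IsRegularGroup A) :
    IsImprimitive (evenPart (baseGroup p A)) ∧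
    2 ^ l - 2 ≤ (imprimitivitySystems (evenPart (baseGroup p A))).ncard ∧
    (codirections p).ncard = l ∧
    (¬ (m.Prime ∧ m % 4 = 3 ∧ Nonempty (A ≃* DihedralGroup m) ∧ l = 2) →
      imprimitivitySystemsOfOrder (evenPart (baseGroup p A)) m = codirections p) ∧
    ((m.Prime ∧ m % 4 = 3 ∧ Nonempty (A ≃* DihedralGroup m) ∧ l = 2) →
      (imprimitivitySystemsOfOrder (evenPart (baseGroup p A)) m).ncard = m + 1 ∧
      codirections p ⊆ imprimitivitySystemsOfOrder (evenPart (baseGroup p A)) m) := by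
  have : Nontrivial (Fin m) := Fin.nontrivial_iff_two_le.2 hm
  have hA : ∀ x : Fin m, MulAction.stabilizer A x ≠ ⊥ := by
    refine stabilizer_ne_bot_of_exists ?_
    by_contra! h
    exact hreg ⟨inferInstance, h⟩
  have hcod := codirections_subset p A hl hA
  have hframe : ∀ x : Fin m, (∀ a : A, a • x = x → coordSign l A a = 1 → a = 1) →
      ∃ c t, IsDihedralFrame (coordSign l A) m x c t := by
    intro x hx
    simpa using exists_isDihedralFrame (x := x) hA hx
  refine ⟨⟨isPretransitive_evenPart_baseGroup p A hA, ?_⟩,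
    le_ncard_imprimitivitySystems p A (by omega) hA, ncard_codirections p, ?_, ?_⟩
  · exact ⟨_, (hcod ⟨⟨0, by omega⟩, rfl⟩).1⟩
  · intro hex
    refine imprimitivitySystemsOfOrder_eq_codirections p A hm hl hA ?_
    -- If neither hypothesis holds, then `l = 2` and some point has trivial stabilizer in the kernel
    -- of the sign; the resulting frame puts `A` in the excluded dihedral case.
    by_contra! hcon
    obtain ⟨⟨x, hx⟩, hl3⟩ := hcon
    obtain ⟨c, t, h⟩ := hframe x fun a hax ha => by
      by_contra ha1
      exact hx a ha1 hax ha
    exact hex ⟨h.prime, h.mod_four, h.nonempty_mulEquiv, by omega⟩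
  · rintro ⟨-, hm4, hD, rfl⟩
    refine ⟨?_, hcod⟩
    obtain ⟨c, t, h⟩ := hframe ⟨0, by omega⟩ (eq_one_of_coordSign_eq_one A hA hm4 hD _)
    exact ncard_imprimitivitySystemsOfOrder_of_isDihedralFrame p A hA h
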